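/- Let $n$ be an even integer with $2\le n\le 14$. A matching on $[n]=\{1,\dots,n\}$ is a partition of $[n]$ into $n/2$ pairs. Let $\mathcal R$ be a maximal pairwise disjoint set of matchings on $[n]$, that is, a set of $n-1$ matchings no two of which have a pair in common. For $x\in\{0,1\}^n$ let $|\phi_x\rangle=\frac1{\sqrt n}\sum_{i=1}^n(-1)^{x_i}|i\rangle$ be the hidden matching state and $\phi_x=|\phi_x\rangle\langle\phi_x|$. A verifier who holds a state $\rho$ chooses $M\in\mathcal R$ uniformly at random and measures $\rho$ in the orthonormal basis consisting of the vectors $\frac1{\sqrt2}(|i\rangle+(-1)^b|j\rangle)$ with $\{i,j\}\in M$, $i<j$, $b\in\{0,1\}$. The answer $(i,j,b)$ so obtained is incorrect for $x$ if $b\ne x_i\oplus x_j$. Let $\Psi$ be any quantum channel (completely positive trace preserving linear map) from $L(\mathbb C^n)$ to $L(\mathbb C^n\otimes\mathbb C^n)$. Put $\eta_x=\mathrm{Tr}_2\,\Psi(\phi_x)$ and $\tau_x=\mathrm{Tr}_1\,\Psi(\phi_x)$, where $\mathrm{Tr}_1$ and $\mathrm{Tr}_2$ are the partial traces over the first and the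 second tensor factor. Let $p_{\mathrm{Ver}_1}$ (resp. $p_{\mathrm{Ver}_2}$) be the probability that a verifier holding $\eta_x$ (resp. $\tau_x$) gets an incorrect answer for $x$, where $x$ is uniformly random in $\{0,1\}^n$. Let $F=2^{-n}\sum_x\langle\phi_x|\eta_x|\phi_x\rangle$ and $G=2^{-n}\sum_x\langle\phi_x|\tau_x|\phi_x\rangle$ be the average fidelities, and let $$Q(n)=\frac1{2^{n+1}}\sum_{x\in\{0,1\}^n}\bigl(\phi_x\otimes\phi_x\otimes 1+\phi_x\otimes 1\otimes\phi_x\bigr),$$ with operator norm $\|Q(n)\|_\infty$. Then $$p_{\mathrm{Ver}_1}=\frac{n}{2(n-1)}(1-F),\qquad p_{\mathrm{Ver}_2}=\frac{n}{2(n-1)}(1-G),$$ $$\frac{F+G}2\le n\,\|Q(n)\|_\infty\le\frac12+\frac1n,$$ and consequently $$p_{\mathrm{Ver}_1}+p_{\mathrm{Ver}_2}\ \ge\ \frac12-\frac1{2(n-1)}.$$ -/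

import Mathlib

open scoped Kronecker ComplexOrder

namespace HiddenMatching

noncomputable section

/-- A (perfect) matching on `[n]`: a partition of the set into pairs. -/
def IsMatching {n : ℕ} (M : Finpartition (Finset.univ : Finset (Fin n))) : Prop :=
  ∀ e ∈ M.parts, e.card = 2

/-- A maximal pairwise disjoint set of matchings on `[n]`: a set of `n - 1` matchings, no two of
which have a pair in common. -/
structure IsMaximalDisjoint {n : ℕ}
    (R : Finset (Finpartition (Finset.univ : Finset (Fin n)))) : Prop where
  isMatching : ∀ M ∈ R, IsMatching M
  pairwise_disjoint : ∀ M ∈ R, ∀ M' ∈ R, M ≠ M' → Disjoint M.parts M'.parts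
  card_eq : R.card = n - 1

/-- The vector `|φ_x⟩ = n^{-1/2} ∑ i, (-1)^{x_i} |i⟩`. -/
def stateVec {n : ℕ} (x : Fin n → Bool) : Fin n → ℂ :=
  fun i => ((1 / Real.sqrt n : ℝ) : ℂ) * (-1) ^ (x i).toNat

/-- `|v⟩⟨v|`. -/
def ketbra {m : Type*} (v : m → ℂ) : Matrix m m ℂ :=
  Matrix.vecMulVec v (star v)

/-- `⟨v| η |v⟩`, a real number when `η` is Hermitian. -/
def expectation {m : Type*} [Fintype m] (v : m → ℂ) (η : Matrix m m ℂ) : ℝ :=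
  (star v ⬝ᵥ η.mulVec v).re

/-- The hidden matching relation `σ_M`: on input `x`, the answer `(i, j, b)` is correct if `{i, j}`
is a pair of the matching and `b = x_i ⊕ x_j`. -/
def relation {n : ℕ} (M : Finpartition (Finset.univ : Finset (Fin n))) :
    Set ((Fin n → Bool) × (Fin n × Fin n × Bool)) :=
  {p | ({p.2.1, p.2.2.1} : Finset (Fin n)) ∈ M.parts ∧
    (p.1 p.2.1 ^^ p.1 p.2.2.1) = p.2.2.2}

/-- The unit vector `(|i⟩ + (-1)^b |j⟩) / √2`, whose outcome is reported as the answer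
`(i, j, b)`. -/
def outcomeVec {n : ℕ} (a : Fin n × Fin n × Bool) : Fin n → ℂ :=
  ((1 / Real.sqrt 2 : ℝ) : ℂ) •
    (Pi.single a.1 1 + ((-1 : ℂ) ^ a.2.2.toNat) • Pi.single a.2.1 1)

/-- The outcomes of the measurement attached to `M`: every pair of `M` is listed once, with its
smaller element first, and with both values of the bit. -/
def outcomes {n : ℕ} (M : Finpartition (Finset.univ : Finset (Fin n))) :
    Finset (Fin n × Fin n × Bool) :=
  Finset.univ.filter fun a => a.1 < a.2.1 ∧ ({a.1, a.2.1} : Finset (Fin n)) ∈ M.parts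

open Classical in
/-- The probability that measuring `η` in the basis attached to `M` yields an answer that is
incorrect for the input `x`. -/
def errorProbOn {n : ℕ} (M : Finpartition (Finset.univ : Finset (Fin n))) (x : Fin n → Bool)
    (η : Matrix (Fin n) (Fin n) ℂ) : ℝ :=
  ∑ a ∈ (outcomes M).filter (fun a => (x, a) ∉ relation M), expectation (outcomeVec a) η

/-- The average of `errorProbOn` over a uniformly random matching in `R`. -/
def errorProbAt {n : ℕ} (R : Finset (Finpartition (Finset.univ : Finset (Fin n))))
    (x : Fin n → Bool) (η : Matrix (Fin n) (Fin n) ℂ) : ℝ :=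
  (1 / (R.card : ℝ)) * ∑ M ∈ R, errorProbOn M x η

/-- The error probability of a verifier who receives the state `η x` when the secret string is
`x`, averaged over the uniformly random string `x` and matching in `R`. -/
def errorProb {n : ℕ} (R : Finset (Finpartition (Finset.univ : Finset (Fin n))))
    (η : (Fin n → Bool) → Matrix (Fin n) (Fin n) ℂ) : ℝ :=
  (1 / (2 : ℝ) ^ n) * ∑ x : Fin n → Bool, errorProbAt R x (η x)

/-- The average over a uniformly random string `x` of the fidelity `⟨φ_x| η x |φ_x⟩`. -/
def avgFidelity {n : ℕ} (η : (Fin n → Bool) → Matrix (Fin n) (Fin n) ℂ) : ℝ :=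
  (1 / (2 : ℝ) ^ n) * ∑ x : Fin n → Bool, expectation (stateVec x) (η x)

/-- The map `id_k ⊗ Ψ`. -/
def ampliation {m l : Type*} (Ψ : Matrix m m ℂ →ₗ[ℂ] Matrix l l ℂ) (k : ℕ)
    (A : Matrix (Fin k × m) (Fin k × m) ℂ) : Matrix (Fin k × l) (Fin k × l) ℂ :=
  Matrix.of fun p q => Ψ (Matrix.of fun i j => A (p.1, i) (q.1, j)) p.2 q.2

/-- A quantum channel: a completely positive and trace preserving linear map. -/
structure IsChannel {m l : Type*} [Fintype m] [Fintype l]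
    (Ψ : Matrix m m ℂ →ₗ[ℂ] Matrix l l ℂ) : Prop where
  completelyPositive : ∀ (k : ℕ) (A : Matrix (Fin k × m) (Fin k × m) ℂ),
    A.PosSemidef → (ampliation Ψ k A).PosSemidef
  tracePreserving : ∀ A : Matrix m m ℂ, (Ψ A).trace = A.trace

/-- The partial trace over the second tensor factor. -/
def traceSnd {m l : Type*} [Fintype l] (A : Matrix (m × l) (m × l) ℂ) : Matrix m m ℂ :=
  Matrix.of fun i j => ∑ k, A (i, k) (j, k)

/-- The partial trace over the first tensor factor. -/
def traceFst {m l : Type*} [Fintype m] (A : Matrix (m × l) (m × l) ℂ) : Matrix l l ℂ :=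
  Matrix.of fun i j => ∑ k, A (k, i) (k, j)

/-- The state `η_x` that the first verifier receives. -/
def firstState {n : ℕ}
    (Ψ : Matrix (Fin n) (Fin n) ℂ →ₗ[ℂ] Matrix (Fin n × Fin n) (Fin n × Fin n) ℂ)
    (x : Fin n → Bool) : Matrix (Fin n) (Fin n) ℂ :=
  traceSnd (Ψ (ketbra (stateVec x)))

/-- The state `τ_x` that the second verifier receives. -/
def secondState {n : ℕ}
    (Ψ : Matrix (Fin n) (Fin n) ℂ →ₗ[ℂ] Matrix (Fin n × Fin n) (Fin n × Fin n) ℂ)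
    (x : Fin n → Bool) : Matrix (Fin n) (Fin n) ℂ :=
  traceFst (Ψ (ketbra (stateVec x)))

/-- `Q(n) = 2^{-(n+1)} ∑ x, (φ_x ⊗ φ_x ⊗ 1 + φ_x ⊗ 1 ⊗ φ_x)`. -/
def Q (n : ℕ) : Matrix (Fin n × Fin n × Fin n) (Fin n × Fin n × Fin n) ℂ :=
  (1 / (2 : ℂ) ^ (n + 1)) • ∑ x : Fin n → Bool,
    (ketbra (stateVec x) ⊗ₖ (ketbra (stateVec x) ⊗ₖ (1 : Matrix (Fin n) (Fin n) ℂ)) +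
      ketbra (stateVec x) ⊗ₖ ((1 : Matrix (Fin n) (Fin n) ℂ) ⊗ₖ ketbra (stateVec x)))

/-- The operator norm of a matrix, acting on Euclidean space. -/
def opNorm {m : Type*} [Fintype m] [DecidableEq m] (A : Matrix m m ℂ) : ℝ :=
  ‖Matrix.toEuclideanCLM (n := m) (𝕜 := ℂ) A‖

end

end HiddenMatching

/-! Errors and fidelities: an edge-disjoint family of `n - 1` matchings covers every pair exactly
once. Averaging over the family therefore sums the two-level error terms over all pairs, which gives
an affine function of `⟨φ_x|η|φ_x⟩`, separately for each `x`. This reduces the claim to an upper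
bound on `F + G`.

Fidelities and `Q(n)`: the Choi matrix `C` of the channel is positive semidefinite with trace `n`,
and `(F + G)/2 = Tr(C Q(n))` because each `φ_x` equals its own transpose. Hence `(F + G)/2 ≤ n
‖Q(n)‖`.

Norm of `Q(n)`: its entries are real, so it suffices to bound its quadratic form on real tensors `v
i j k`. Averaging over `x` is a fourth moment of independent signs, which only sees index pairings
(`sum_sq_sgn_form`). What remains is `two_marginals_bound`, with constant `n + 2 = 4 + (n - 2)`. The
plain norms and the swap overlaps account for `4‖v‖²`. The squared traces are paid for by the swap
defects and the diagonal corrections, up to `(n - 2)‖v‖²`. This last estimate decouples over `a`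
into sectors spanned by the entries `v a b b`, `v b a b`, `v b b a`, where it is an elementary
inequality (`sector_bound`). -/

namespace HiddenMatching

/-! ### Fourth moments of random signs -/

/-- The sign `(-1)^{x_i}`. -/
def sgn {n : ℕ} (x : Fin n → Bool) (i : Fin n) : ℝ := (-1) ^ (x i).toNat

lemma sgn_mul_self {n : ℕ} (x : Fin n → Bool) (i : Fin n) : sgn x i * sgn x i = 1 := by
  unfold sgn; cases x i <;> norm_num

/-- Flipping the bit `x i` negates each summand, since none of the other three indices is `i`; those
three may coincide with one another. -/
lemma sum_sgn_of_ne {n : ℕ} {i j k l : Fin n} (hj : j ≠ i) (hk : k ≠ i) (hl : l ≠ i) :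
    ∑ x : Fin n → Bool, sgn x i * sgn x j * sgn x k * sgn x l = 0 := by
  refine Finset.sum_involution (fun x _ => Function.update x i (!x i)) ?_ ?_ ?_ ?_
  · intro x _
    simp only [sgn, Function.update_self, Function.update_of_ne hj, Function.update_of_ne hk,
      Function.update_of_ne hl]
    cases x i <;> simp
  · intro x _ _ h
    have := congrFun h i
    simp at this
  · simp
  · intro x _
    simp

/-- The average is 1 when the four indices can be paired off and 0 otherwise. If all four agree, the
three pairings each contribute 1, so 2 has to be subtracted. -/
lemma sum_sgn_four {n : ℕ} (i j k l : Fin n) :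
    ∑ x : Fin n → Bool, sgn x i * sgn x j * sgn x k * sgn x l =
      2 ^ n * ((if i = j ∧ k = l then 1 else 0) + (if i = k ∧ j = l then 1 else 0) +
        (if i = l ∧ j = k then 1 else 0) - 2 * (if i = j ∧ i = k ∧ i = l then 1 else 0)) := by
  have card : ∑ _x : Fin n → Bool, (1 : ℝ) = 2 ^ n := by simp
  have one : ∀ a b c d : Fin n, a = b → c = d →
      ∑ x : Fin n → Bool, sgn x a * sgn x b * sgn x c * sgn x d = 2 ^ n := by
    rintro a b c d rfl rfl
    rw [← card]
    refine Finset.sum_congr rfl fun x _ => ?_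
    rw [sgn_mul_self, one_mul, sgn_mul_self]
  have swap₁ : ∑ x : Fin n → Bool, sgn x i * sgn x j * sgn x k * sgn x l =
      ∑ x : Fin n → Bool, sgn x i * sgn x k * sgn x j * sgn x l :=
    Finset.sum_congr rfl fun x _ => by ring
  have swap₂ : ∑ x : Fin n → Bool, sgn x i * sgn x j * sgn x k * sgn x l =
      ∑ x : Fin n → Bool, sgn x i * sgn x l * sgn x j * sgn x k :=
    Finset.sum_congr rfl fun x _ => by ring
  have swap₃ : ∑ x : Fin n → Bool, sgn x i * sgn x j * sgn x k * sgn x l =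
      ∑ x : Fin n → Bool, sgn x j * sgn x i * sgn x k * sgn x l :=
    Finset.sum_congr rfl fun x _ => by ring
  have swap₄ : ∑ x : Fin n → Bool, sgn x i * sgn x j * sgn x k * sgn x l =
      ∑ x : Fin n → Bool, sgn x k * sgn x i * sgn x j * sgn x l :=
    Finset.sum_congr rfl fun x _ => by ring
  by_cases hij : i = j
  · by_cases hkl : k = l
    · rw [one _ _ _ _ hij hkl]
      subst hij hkl
      by_cases h : i = k
      · subst h
        norm_num
      · simp [h]
    · subst hij
      by_cases hki : i = k
      · subst hki
        rw [show (∑ x : Fin n → Bool, sgn x i * sgn x i * sgn x i * sgn x l) =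
          ∑ x : Fin n → Bool, sgn x l * sgn x i * sgn x i * sgn x i from
            Finset.sum_congr rfl fun x _ => by ring, sum_sgn_of_ne hkl hkl hkl]
        simp [hkl]
      · rw [swap₄, sum_sgn_of_ne hki hki (Ne.symm hkl)]
        simp [hki, hkl]
  · by_cases hik : i = k
    · by_cases hjl : j = l
      · rw [swap₁, one _ _ _ _ hik hjl]
        subst hik hjl
        simp [hij, Ne.symm hij]
      · subst hik
        rw [swap₃, sum_sgn_of_ne hij hij (Ne.symm hjl)]
        simp [hij, hjl, Ne.symm hij]
    · by_cases hil : i = l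
      · by_cases hjk : j = k
        · rw [swap₂, one _ _ _ _ hil hjk]
          subst hil hjk
          simp [hij]
        · subst hil
          rw [swap₃, sum_sgn_of_ne hij (Ne.symm hjk) hij]
          simp [hij, hjk, hik]
      · rw [sum_sgn_of_ne (Ne.symm hij) (Ne.symm hik) (Ne.symm hil)]
        simp [hij, hik, hil]

lemma sum_sq_sgn_form {n : ℕ} (u : Fin n → Fin n → ℝ) :
    ∑ x : Fin n → Bool, (∑ i, ∑ j, sgn x i * sgn x j * u i j) ^ 2 =
      2 ^ n * ((∑ i, u i i) ^ 2 + ∑ i, ∑ j, u i j ^ 2 + ∑ i, ∑ j, u i j * u j i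
        - 2 * ∑ i, u i i ^ 2) := by
  have expand : ∀ x : Fin n → Bool, (∑ i, ∑ j, sgn x i * sgn x j * u i j) ^ 2 =
      ∑ i, ∑ j, ∑ k, ∑ l, u i j * u k l * (sgn x i * sgn x j * sgn x k * sgn x l) := by
    intro x
    rw [sq, Finset.sum_mul]
    refine Finset.sum_congr rfl fun i _ => ?_
    rw [Finset.sum_mul]
    refine Finset.sum_congr rfl fun j _ => ?_
    rw [Finset.mul_sum]
    refine Finset.sum_congr rfl fun k _ => ?_
    rw [Finset.mul_sum]
    exact Finset.sum_congr rfl fun l _ => by ring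
  have swap : ∑ x : Fin n → Bool, ∑ i, ∑ j, ∑ k, ∑ l,
        u i j * u k l * (sgn x i * sgn x j * sgn x k * sgn x l) =
      ∑ i, ∑ j, ∑ k, ∑ l,
        u i j * u k l * ∑ x : Fin n → Bool, sgn x i * sgn x j * sgn x k * sgn x l := by
    rw [Finset.sum_comm]
    refine Finset.sum_congr rfl fun i _ => ?_
    rw [Finset.sum_comm]
    refine Finset.sum_congr rfl fun j _ => ?_
    rw [Finset.sum_comm]
    refine Finset.sum_congr rfl fun k _ => ?_
    rw [Finset.sum_comm]
    exact Finset.sum_congr rfl fun l _ => by rw [Finset.mul_sum]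
  simp only [expand, swap, sum_sgn_four]
  have distrib : ∀ i j k l : Fin n, u i j * u k l * (2 ^ n *
      ((if i = j ∧ k = l then 1 else 0) + (if i = k ∧ j = l then 1 else 0) +
        (if i = l ∧ j = k then 1 else 0) - 2 * (if i = j ∧ i = k ∧ i = l then 1 else 0))) =
      2 ^ n * ((if i = j ∧ k = l then u i j * u k l else 0) +
        (if i = k ∧ j = l then u i j * u k l else 0) +
        (if i = l ∧ j = k then u i j * u k l else 0) -
        2 * (if i = j ∧ i = k ∧ i = l then u i j * u k l else 0)) := by
    intro i j k l
    generalize u i j * u k l = t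
    generalize (2 : ℝ) ^ n = c
    split_ifs <;> ring
  simp only [distrib, ← Finset.mul_sum, Finset.sum_add_distrib, Finset.sum_sub_distrib]
  simp only [ite_and]
  congr 2
  · congr 1
    · congr 1
      · have h : ∀ i j : Fin n, (∑ k, ∑ l, if i = j then if k = l then u i j * u k l else 0 else 0)
            = if i = j then u i j * ∑ k, u k k else 0 := by
          intro i j
          split_ifs <;> simp [Finset.mul_sum]
        simp only [h, Finset.sum_ite_eq, Finset.mem_univ, if_true, sq, Finset.sum_mul]
      · refine Finset.sum_congr rfl fun i _ => Finset.sum_congr rfl fun j _ => ?_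
        rw [Finset.sum_eq_single i (by intro b _ hb; simp [Ne.symm hb]) (by simp)]
        simp [sq]
    · refine Finset.sum_congr rfl fun i _ => Finset.sum_congr rfl fun j _ => ?_
      rw [Finset.sum_eq_single j (by intro b _ hb; simp [Ne.symm hb]) (by simp)]
      simp
  · congr 1
    refine Finset.sum_congr rfl fun i _ => ?_
    rw [Finset.sum_eq_single i (by intro b _ hb; simp [Ne.symm hb]) (by simp),
      Finset.sum_eq_single i (by intro b _ hb; simp [Ne.symm hb]) (by simp)]
    simp [sq]

/-! ### The tensor inequality behind the norm bound -/

/-- Completing the square in `w` and in each `x b` leaves a quadratic form in `y` and `z`. It splits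
into the variables `y + z` and `y - z`, and Cauchy–Schwarz handles each. -/
lemma sector_bound {ι : Type*} (s : Finset ι) (w : ℝ) (x y z : ι → ℝ) :
    (w + ∑ b ∈ s, z b) ^ 2 + (w + ∑ b ∈ s, y b) ^ 2 + ∑ b ∈ s, (x b + y b) ^ 2 +
        ∑ b ∈ s, (x b + z b) ^ 2 ≤
      (s.card + 3) * (w ^ 2 + ∑ b ∈ s, (x b ^ 2 + y b ^ 2 + z b ^ 2)) := by
  set m : ℝ := (s.card : ℝ)
  have hm : 0 ≤ m := Nat.cast_nonneg _
  have hm1 : 0 < m + 1 := by linarith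
  have hT := sq_sum_le_card_mul_sum_sq (s := s) (f := fun b => y b + z b)
  have hD := sq_sum_le_card_mul_sum_sq (s := s) (f := fun b => y b - z b)
  have hx : 0 ≤ ∑ b ∈ s, ((m + 1) * x b - (y b + z b)) ^ 2 :=
    Finset.sum_nonneg fun b _ => sq_nonneg _
  have hd : 0 ≤ ∑ b ∈ s, (y b - z b) ^ 2 := Finset.sum_nonneg fun b _ => sq_nonneg _
  have hw := sq_nonneg ((m + 1) * w - (∑ b ∈ s, y b + ∑ b ∈ s, z b))
  have ex : ∀ b, ((m + 1) * x b - (y b + z b)) ^ 2 = (m + 1) ^ 2 * x b ^ 2 -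
      2 * (m + 1) * (x b * y b) - 2 * (m + 1) * (x b * z b) + y b ^ 2 + z b ^ 2 +
        2 * (y b * z b) := fun b => by ring
  have e1 : ∀ b, (x b + y b) ^ 2 = x b ^ 2 + 2 * (x b * y b) + y b ^ 2 := fun b => by ring
  have e2 : ∀ b, (x b + z b) ^ 2 = x b ^ 2 + 2 * (x b * z b) + z b ^ 2 := fun b => by ring
  have e3 : ∀ b, (y b + z b) ^ 2 = y b ^ 2 + 2 * (y b * z b) + z b ^ 2 := fun b => by ring
  have e4 : ∀ b, (y b - z b) ^ 2 = y b ^ 2 - 2 * (y b * z b) + z b ^ 2 := fun b => by ring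
  simp only [ex, e1, e2, e3, e4, Finset.sum_add_distrib, Finset.sum_sub_distrib,
    ← Finset.mul_sum] at *
  set Y := ∑ b ∈ s, y b
  set Z := ∑ b ∈ s, z b
  set XX := ∑ b ∈ s, x b ^ 2
  set YY := ∑ b ∈ s, y b ^ 2
  set ZZ := ∑ b ∈ s, z b ^ 2
  set XY := ∑ b ∈ s, x b * y b
  set XZ := ∑ b ∈ s, x b * z b
  set YZ := ∑ b ∈ s, y b * z b
  have hT' := mul_le_mul_of_nonneg_left hT (show 0 ≤ m + 3 by linarith)
  have hD' := mul_le_mul_of_nonneg_left hD hm1.le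
  have hd' := mul_nonneg hm1.le hd
  -- With `m = s.card`, the gap times `m + 1` is exactly `hw` plus `hx`, plus `(m + 3)/2` times the
  -- Cauchy–Schwarz gap for `y + z`, plus `(m + 1)/2` times the one for `y - z`, plus `(m + 1) ∑ (y
  -- b - z b)²`.
  refine le_of_mul_le_mul_left ?_ hm1
  nlinarith

/-- The form in which `sector_bound` is used: the three families share the entry `v a a a` at `b =
a`, which plays the role of `w` and must be counted once, not three times. With `s.card = n - 1` the
constant is `n + 2`, and moving `4` times the squared norm to the left leaves `n - 2`. -/
lemma sector_bound_univ {n : ℕ} (a : Fin n) (x y z : Fin n → ℝ) (hxy : y a = x a)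
    (hxz : z a = x a) :
    (∑ b, z b) ^ 2 + (∑ b, y b) ^ 2 -
        ∑ b, ((y b - x b) ^ 2 + (z b - x b) ^ 2 + 2 * z b ^ 2 + 2 * y b ^ 2) ≤
      ((n : ℝ) - 2) * (∑ b, (x b ^ 2 + y b ^ 2 + z b ^ 2) - 2 * x a ^ 2) := by
  have h := sector_bound (Finset.univ.erase a) (x a) x y z
  have hn : 1 ≤ n := Nat.one_le_of_lt a.pos
  have split : ∀ f : Fin n → ℝ, ∑ b, f b = f a + ∑ b ∈ Finset.univ.erase a, f b := fun f =>
    (Finset.add_sum_erase _ f (Finset.mem_univ a)).symm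
  rw [Finset.card_erase_of_mem (Finset.mem_univ a), Finset.card_univ, Fintype.card_fin,
    Nat.cast_sub hn, Nat.cast_one] at h
  simp only [split, hxy, hxz]
  have e : ∀ b, (y b - x b) ^ 2 + (z b - x b) ^ 2 + 2 * z b ^ 2 + 2 * y b ^ 2 =
      4 * (x b ^ 2 + y b ^ 2 + z b ^ 2) - (x b + y b) ^ 2 - (x b + z b) ^ 2 := fun b => by ring
  simp only [e, Finset.sum_sub_distrib, ← Finset.mul_sum]
  linarith

/-- The planes `j = k`, `i = k`, `i = j` meet pairwise only in the main diagonal. After removing two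
of its three copies, each entry is counted at most once. -/
lemma sum_three_diagonals_le {n : ℕ} (v : Fin n → Fin n → Fin n → ℝ) :
    ∑ a, (∑ b, (v a b b ^ 2 + v b a b ^ 2 + v b b a ^ 2) - 2 * v a a a ^ 2) ≤
      ∑ i, ∑ j, ∑ k, v i j k ^ 2 := by
  have h : ∀ i j k : Fin n, (if k = j then v i j k ^ 2 else 0) + (if k = i then v i j k ^ 2 else 0)
      + (if j = i then v i j k ^ 2 else 0) -
      2 * (if j = i then if k = i then v i j k ^ 2 else 0 else 0) ≤ v i j k ^ 2 := by
    intro i j k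
    have := sq_nonneg (v i j k)
    split_ifs <;> simp_all
    nlinarith
  have hsum := Finset.sum_le_sum fun i (_ : i ∈ Finset.univ) =>
    Finset.sum_le_sum fun j (_ : j ∈ Finset.univ) =>
      Finset.sum_le_sum fun k (_ : k ∈ Finset.univ) => h i j k
  refine le_trans (le_of_eq ?_) hsum
  have third : ∀ i j : Fin n, (∑ k, if j = i then v i j k ^ 2 else 0) =
      if j = i then ∑ k, v i j k ^ 2 else 0 := by
    intro i j; split_ifs <;> simp
  have fourth : ∀ i j : Fin n, (∑ k, if j = i then if k = i then v i j k ^ 2 else 0 else 0) =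
      if j = i then v i j i ^ 2 else 0 := by
    intro i j; split_ifs <;> simp
  simp only [Finset.sum_add_distrib, Finset.sum_sub_distrib, ← Finset.mul_sum, third, fourth,
    Finset.sum_ite_eq', Finset.mem_univ, if_true]
  rw [Finset.sum_comm (f := fun a b => v b a b ^ 2), Finset.sum_comm (f := fun a b => v b b a ^ 2)]

/-- Polarization writes the overlap of `v` with its swap as `‖v‖²` minus half the squared swap
defect. Of the defect only the planes `k = i` and `k = j` are kept; they contribute equally, which
cancels the half, and on their intersection the defect vanishes. -/
lemma sum_mul_swap_le {n : ℕ} (v : Fin n → Fin n → Fin n → ℝ) :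
    ∑ i, ∑ j, ∑ k, v i j k * v j i k ≤
      ∑ i, ∑ j, ∑ k, v i j k ^ 2 - ∑ a, ∑ b, (v b a b - v a b b) ^ 2 := by
  have h : ∀ i j k : Fin n, (if k = i then (v i j k - v j i k) ^ 2 else 0) +
      (if k = j then (v i j k - v j i k) ^ 2 else 0) ≤ (v i j k - v j i k) ^ 2 := by
    intro i j k
    have := sq_nonneg (v i j k - v j i k)
    split_ifs <;> simp_all
  have hsum := Finset.sum_le_sum fun i (_ : i ∈ Finset.univ) =>
    Finset.sum_le_sum fun j (_ : j ∈ Finset.univ) =>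
      Finset.sum_le_sum fun k (_ : k ∈ Finset.univ) => h i j k
  have e : ∀ i j k : Fin n, (v i j k - v j i k) ^ 2 =
      v i j k ^ 2 + v j i k ^ 2 - 2 * (v i j k * v j i k) := fun i j k => by ring
  have hl : ∑ i, ∑ j, ∑ k, (v i j k - v j i k) ^ 2 =
      2 * ∑ i, ∑ j, ∑ k, v i j k ^ 2 - 2 * ∑ i, ∑ j, ∑ k, v i j k * v j i k := by
    simp only [e, Finset.sum_add_distrib, Finset.sum_sub_distrib, ← Finset.mul_sum]
    rw [Finset.sum_comm (f := fun i j => ∑ k, v j i k ^ 2)]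
    ring
  rw [hl] at hsum
  simp only [Finset.sum_add_distrib, Finset.sum_ite_eq', Finset.mem_univ, if_true] at hsum
  have h1 : ∑ i, ∑ j, (v i j i - v j i i) ^ 2 = ∑ a, ∑ b, (v b a b - v a b b) ^ 2 := by
    rw [Finset.sum_comm]
  have h2 : ∑ i, ∑ j, (v i j j - v j i j) ^ 2 = ∑ a, ∑ b, (v b a b - v a b b) ^ 2 :=
    Finset.sum_congr rfl fun _ _ => Finset.sum_congr rfl fun _ _ => by ring
  linarith

/-- The two swap bounds produce the defects `(y - x)²` and `(z - x)²` needed in each sector, and the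
`-2` diagonal corrections produce `2 z²` and `2 y²`. Summing the sector bounds over `a` then leaves
`(n - 2)‖v‖²` on top of `4‖v‖²`. -/
lemma two_marginals_bound {n : ℕ} (hn : 2 ≤ n) (v : Fin n → Fin n → Fin n → ℝ) :
    ∑ k, ((∑ i, v i i k) ^ 2 + ∑ i, ∑ j, v i j k ^ 2 + ∑ i, ∑ j, v i j k * v j i k
        - 2 * ∑ i, v i i k ^ 2) +
      ∑ k, ((∑ i, v i k i) ^ 2 + ∑ i, ∑ j, v i k j ^ 2 + ∑ i, ∑ j, v i k j * v j k i
        - 2 * ∑ i, v i k i ^ 2) ≤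
      ((n : ℝ) + 2) * ∑ i, ∑ j, ∑ k, v i j k ^ 2 := by
  have rot : ∀ f : Fin n → Fin n → Fin n → ℝ,
      ∑ k, ∑ i, ∑ j, f i j k = ∑ i, ∑ j, ∑ k, f i j k := by
    intro f
    rw [Finset.sum_comm]
    exact Finset.sum_congr rfl fun i _ => Finset.sum_comm
  have s1 := sum_mul_swap_le v
  have s2 := sum_mul_swap_le fun i j k => v i k j
  have s3 := sum_three_diagonals_le v
  have s4 := Finset.sum_le_sum fun a (_ : a ∈ Finset.univ) =>
    sector_bound_univ a (fun b => v a b b) (fun b => v b a b) (fun b => v b b a) rfl rfl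
  have hn' : (0 : ℝ) ≤ (n : ℝ) - 2 := by
    have : (2 : ℝ) ≤ n := by exact_mod_cast hn
    linarith
  have s5 := mul_le_mul_of_nonneg_left s3 hn'
  have sq' : ∑ i, ∑ j, ∑ k, v i k j ^ 2 = ∑ i, ∑ j, ∑ k, v i j k ^ 2 :=
    Finset.sum_congr rfl fun i _ => Finset.sum_comm
  simp only [Finset.sum_add_distrib, Finset.sum_sub_distrib, ← Finset.mul_sum]
    at s1 s2 s3 s4 s5 ⊢
  rw [rot fun i j k => v i j k ^ 2, rot fun i j k => v i j k * v j i k,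
    rot fun i j k => v i k j ^ 2, rot fun i j k => v i k j * v j k i, sq']
  rw [sq'] at s2
  have c1 := Finset.sum_comm (s := Finset.univ) (t := Finset.univ) (f := fun k i => v i i k ^ 2)
  have c2 := Finset.sum_comm (s := Finset.univ) (t := Finset.univ) (f := fun k i => v i k i ^ 2)
  linarith

/-! ### Positive semidefinite matrices and the operator norm -/

section Matrices

variable {m : Type*} [Fintype m]

-- A factorization `Bᵀ B` survives the passage to complex entries, so for a real matrix it is enough
-- to test positivity on real vectors.
open scoped MatrixOrder in
lemma posSemidef_map_ofReal [DecidableEq m] {A : Matrix m m ℝ} (hA : A.PosSemidef) :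
    (A.map ((↑) : ℝ → ℂ)).PosSemidef := by
  obtain ⟨B, rfl⟩ := CStarAlgebra.nonneg_iff_eq_star_mul_self.mp hA.nonneg
  have h : (star B * B).map ((↑) : ℝ → ℂ) =
      (B.map ((↑) : ℝ → ℂ)).conjTranspose * B.map ((↑) : ℝ → ℂ) := by
    ext i j
    simp [Matrix.mul_apply, Matrix.star_eq_conjTranspose]
  rw [h]
  exact Matrix.posSemidef_conjTranspose_mul_self _

open scoped MatrixOrder in
lemma trace_mul_re_nonneg [DecidableEq m] {A B : Matrix m m ℂ} (hA : A.PosSemidef)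
    (hB : B.PosSemidef) : 0 ≤ (A * B).trace.re := by
  obtain ⟨C, rfl⟩ := CStarAlgebra.nonneg_iff_eq_star_mul_self.mp hA.nonneg
  rw [Matrix.mul_assoc, Matrix.trace_mul_comm, Matrix.star_eq_conjTranspose]
  exact (Complex.le_def.mp (hB.mul_mul_conjTranspose_same C).trace_nonneg).1

lemma algebraMap_real_eq [DecidableEq m] (c : ℝ) :
    algebraMap ℝ (Matrix m m ℂ) c = (c : ℂ) • (1 : Matrix m m ℂ) := by
  ext i j
  simp [Matrix.algebraMap_matrix_apply, Matrix.one_apply]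

open scoped MatrixOrder Matrix.Norms.L2Operator in
lemma posSemidef_opNorm_smul_one_sub [DecidableEq m] {A : Matrix m m ℂ} (hA : A.IsHermitian) :
    (((opNorm A : ℝ) : ℂ) • (1 : Matrix m m ℂ) - A).PosSemidef := by
  have h : A ≤ algebraMap ℝ (Matrix m m ℂ) ‖A‖ :=
    IsSelfAdjoint.le_algebraMap_norm_self (show IsSelfAdjoint A from hA)
  rw [Matrix.le_iff, algebraMap_real_eq] at h
  exact h

open scoped MatrixOrder Matrix.Norms.L2Operator in
lemma opNorm_le_of_posSemidef [DecidableEq m] {A : Matrix m m ℂ} (hA : A.PosSemidef) {c : ℝ}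
    (hc : 0 ≤ c) (h : ((c : ℂ) • (1 : Matrix m m ℂ) - A).PosSemidef) : opNorm A ≤ c := by
  refine (CStarAlgebra.norm_le_iff_le_algebraMap A hc hA.nonneg).mpr ?_
  rw [Matrix.le_iff, algebraMap_real_eq]
  exact h

end Matrices

/-! ### The norm of `Q(n)` -/

lemma stateVec_eq {n : ℕ} (x : Fin n → Bool) (i : Fin n) :
    stateVec x i = ((1 / Real.sqrt n * sgn x i : ℝ) : ℂ) := by
  simp [stateVec, sgn]

/-- The matrix `Q(n)` with its entries read as real numbers. -/
noncomputable def realQ (n : ℕ) : Matrix (Fin n × Fin n × Fin n) (Fin n × Fin n × Fin n) ℝ :=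
  Matrix.of fun p q => 1 / 2 ^ (n + 1) * (1 / (n : ℝ) ^ 2) * ∑ x : Fin n → Bool,
    (sgn x p.1 * sgn x q.1 * (sgn x p.2.1 * sgn x q.2.1) * (if p.2.2 = q.2.2 then 1 else 0) +
      sgn x p.1 * sgn x q.1 * (sgn x p.2.2 * sgn x q.2.2) * (if p.2.1 = q.2.1 then 1 else 0))

lemma ketbra_stateVec_apply {n : ℕ} (x : Fin n → Bool) (i j : Fin n) :
    ketbra (stateVec x) i j = ((1 / (n : ℝ) * (sgn x i * sgn x j) : ℝ) : ℂ) := by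
  have h : (1 / Real.sqrt n) * (1 / Real.sqrt n) = 1 / (n : ℝ) := by
    rw [div_mul_div_comm, Real.mul_self_sqrt (Nat.cast_nonneg n), one_mul]
  rw [ketbra, Matrix.vecMulVec_apply, Pi.star_apply, stateVec_eq, stateVec_eq, ← h]
  simp only [RCLike.star_def, Complex.conj_ofReal]
  push_cast
  ring

lemma Q_eq_map (n : ℕ) : Q n = (realQ n).map ((↑) : ℝ → ℂ) := by
  ext ⟨i, j, k⟩ ⟨i', j', k'⟩
  simp only [Q, realQ, Matrix.smul_apply, Matrix.sum_apply, Matrix.add_apply,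
    Matrix.kroneckerMap_apply, Matrix.map_apply, Matrix.of_apply, ketbra_stateVec_apply,
    Matrix.one_apply, smul_eq_mul]
  push_cast
  rw [mul_assoc, Finset.mul_sum (a := 1 / (n : ℂ) ^ 2)]
  congr 1
  refine Finset.sum_congr rfl fun x _ => ?_
  split_ifs <;> push_cast <;> ring

lemma posSemidef_Q (n : ℕ) : (Q n).PosSemidef := by
  unfold Q
  have hk : ∀ x : Fin n → Bool, (ketbra (stateVec x)).PosSemidef := fun x =>
    Matrix.posSemidef_vecMulVec_self_star _
  refine Matrix.PosSemidef.smul (Matrix.posSemidef_sum _ fun x _ => ?_) ?_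
  · exact ((hk x).kronecker ((hk x).kronecker Matrix.PosSemidef.one)).add
      ((hk x).kronecker (Matrix.PosSemidef.one.kronecker (hk x)))
  · have : (1 / (2 : ℂ) ^ (n + 1)) = ((1 / (2 : ℝ) ^ (n + 1) : ℝ) : ℂ) := by push_cast; rfl
    rw [this]
    exact_mod_cast (by positivity : (0 : ℝ) ≤ 1 / (2 : ℝ) ^ (n + 1))

/-- A rank-one projector on two factors tensored with the identity on the third: its form is a
squared overlap for each value of the third index. -/
lemma sum_kronecker_form {n : ℕ} (s : Fin n → ℝ) (v : Fin n × Fin n × Fin n → ℝ) :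
    ∑ p, ∑ q, v p * v q *
        (s p.1 * s q.1 * (s p.2.1 * s q.2.1) * (if p.2.2 = q.2.2 then 1 else 0)) =
      ∑ k, (∑ i, ∑ j, s i * s j * v (i, j, k)) ^ 2 := by
  have sq_eq : ∀ u : Fin n → Fin n → ℝ, (∑ i, ∑ j, s i * s j * u i j) ^ 2 =
      ∑ i, ∑ j, ∑ i', ∑ j', u i j * u i' j' * (s i * s i' * (s j * s j')) := by
    intro u
    rw [sq, Finset.sum_mul]
    refine Finset.sum_congr rfl fun i _ => ?_
    rw [Finset.sum_mul]
    refine Finset.sum_congr rfl fun j _ => ?_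
    rw [Finset.mul_sum]
    refine Finset.sum_congr rfl fun k _ => ?_
    rw [Finset.mul_sum]
    exact Finset.sum_congr rfl fun l _ => by ring
  simp only [sq_eq fun i j => v (i, j, _), Fintype.sum_prod_type, mul_ite, mul_one, mul_zero,
    Finset.sum_ite_eq, Finset.mem_univ, if_true]
  rw [Finset.sum_comm (s := Finset.univ (α := Fin n)) (t := Finset.univ (α := Fin n))
    (f := fun k i => ∑ j, ∑ i', ∑ j', v (i, j, k) * v (i', j', k) * (s i * s i' * (s j * s j')))]
  exact Finset.sum_congr rfl fun i _ => Finset.sum_comm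

lemma realQ_form {n : ℕ} (v : Fin n × Fin n × Fin n → ℝ) :
    v ⬝ᵥ (realQ n).mulVec v = 1 / 2 ^ (n + 1) * (1 / (n : ℝ) ^ 2) *
      (∑ k, ∑ x : Fin n → Bool, (∑ i, ∑ j, sgn x i * sgn x j * v (i, j, k)) ^ 2 +
       ∑ k, ∑ x : Fin n → Bool, (∑ i, ∑ j, sgn x i * sgn x j * v (i, k, j)) ^ 2) := by
  have h : v ⬝ᵥ (realQ n).mulVec v = 1 / 2 ^ (n + 1) * (1 / (n : ℝ) ^ 2) *
      ∑ x : Fin n → Bool, ∑ p, ∑ q, v p * v q *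
    (sgn x p.1 * sgn x q.1 * (sgn x p.2.1 * sgn x q.2.1) * (if p.2.2 = q.2.2 then 1 else 0) +
      sgn x p.1 * sgn x q.1 * (sgn x p.2.2 * sgn x q.2.2) * (if p.2.1 = q.2.1 then 1 else 0)) := by
    rw [Finset.sum_comm, Finset.mul_sum]
    refine Finset.sum_congr rfl fun p _ => ?_
    rw [Finset.sum_comm, Matrix.mulVec, dotProduct, Finset.mul_sum, Finset.mul_sum]
    refine Finset.sum_congr rfl fun q _ => ?_
    rw [realQ, Matrix.of_apply, ← Finset.mul_sum]
    ring
  rw [h, Finset.sum_comm (s := Finset.univ (α := Fin n)) (t := Finset.univ (α := Fin n → Bool)),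
    Finset.sum_comm (s := Finset.univ (α := Fin n)) (t := Finset.univ (α := Fin n → Bool)),
    ← Finset.sum_add_distrib]
  congr 1
  refine Finset.sum_congr rfl fun x _ => ?_
  simp only [mul_add, Finset.sum_add_distrib]
  congr 1
  · exact sum_kronecker_form (sgn x) v
  -- Exchanging the last two tensor factors turns the second summand into the first.
  · rw [← sum_kronecker_form (sgn x) fun p => v (p.1, p.2.2, p.2.1)]
    let e : Fin n × Fin n × Fin n ≃ Fin n × Fin n × Fin n :=
      Equiv.prodCongr (Equiv.refl _) (Equiv.prodComm _ _)
    exact Fintype.sum_equiv e _ _ fun p => Fintype.sum_equiv e _ _ fun q => rfl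

/-- In the constant, `n + 2` comes from `two_marginals_bound`, `1/n²` from the normalisation of two
copies of `φ_x`, and `1/2` from averaging the two summands; the `2 ^ n` of the sign moments cancels
the average over `x`. -/
lemma posSemidef_smul_one_sub_realQ {n : ℕ} (hn : 2 ≤ n) :
    ((((n : ℝ) + 2) / (2 * (n : ℝ) ^ 2)) • (1 : Matrix _ _ ℝ) - realQ n).PosSemidef := by
  refine Matrix.PosSemidef.of_dotProduct_mulVec_nonneg ?_ ?_
  · ext p q
    simp only [realQ, Matrix.conjTranspose_apply, Matrix.sub_apply, Matrix.smul_apply,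
      Matrix.of_apply, Matrix.one_apply, star_trivial, eq_comm (a := q), eq_comm (a := q.2.2),
      eq_comm (a := q.2.1)]
    congr 2
    exact Finset.sum_congr rfl fun x _ => by ring
  · intro v
    rw [Matrix.sub_mulVec, Matrix.smul_mulVec, Matrix.one_mulVec, dotProduct_sub, star_trivial,
      realQ_form, dotProduct_smul]
    simp only [sum_sq_sgn_form fun i j => v (i, j, _), sum_sq_sgn_form fun i j => v (i, _, j)]
    have key := two_marginals_bound hn fun i j k => v (i, j, k)
    rw [← Finset.mul_sum, ← Finset.mul_sum]
    have hv : v ⬝ᵥ v = ∑ i, ∑ j, ∑ k, v (i, j, k) ^ 2 := by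
      simp only [dotProduct, Fintype.sum_prod_type, sq]
    rw [hv, smul_eq_mul]
    have hc : (0 : ℝ) ≤ 1 / (2 * (n : ℝ) ^ 2) := by positivity
    have := mul_le_mul_of_nonneg_left key hc
    rw [← mul_add, pow_succ 2 n]
    have e : ∀ t : ℝ, 1 / ((2 : ℝ) ^ n * 2) * (1 / (n : ℝ) ^ 2) * (2 ^ n * t) =
        1 / (2 * (n : ℝ) ^ 2) * t := by
      intro t
      field_simp
    rw [e, sub_nonneg]
    refine this.trans (le_of_eq ?_)
    ring

lemma mul_opNorm_Q_le {n : ℕ} (hn : 2 ≤ n) : (n : ℝ) * opNorm (Q n) ≤ 1 / 2 + 1 / (n : ℝ) := by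
  have hn0 : (0 : ℝ) < n := by exact_mod_cast (by omega : 0 < n)
  have h : opNorm (Q n) ≤ ((n : ℝ) + 2) / (2 * (n : ℝ) ^ 2) := by
    refine opNorm_le_of_posSemidef (posSemidef_Q n) (by positivity) ?_
    convert posSemidef_map_ofReal (posSemidef_smul_one_sub_realQ hn) using 1
    rw [Q_eq_map]
    ext p q
    by_cases hpq : p = q <;> simp [hpq]
  refine (mul_le_mul_of_nonneg_left h hn0.le).trans (le_of_eq ?_)
  field_simp

/-! ### Choi matrix and average fidelities -/

/-- The unnormalised maximally entangled vector `∑ i, |i⟩|i⟩`. -/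
noncomputable def maxEntangled (m : Type*) [DecidableEq m] : m × m → ℂ :=
  fun p => if p.1 = p.2 then 1 else 0

/-- The Choi matrix of a linear map. -/
noncomputable def choi {l : Type*} {k : ℕ} (Ψ : Matrix (Fin k) (Fin k) ℂ →ₗ[ℂ] Matrix l l ℂ) :
    Matrix (Fin k × l) (Fin k × l) ℂ :=
  ampliation Ψ k (ketbra (maxEntangled (Fin k)))

lemma choi_apply {l : Type*} {k : ℕ} (Ψ : Matrix (Fin k) (Fin k) ℂ →ₗ[ℂ] Matrix l l ℂ)
    (p q : Fin k × l) :
    choi Ψ p q = Ψ (Matrix.single p.1 q.1 1) p.2 q.2 := by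
  have h : (Matrix.of fun i j => ketbra (maxEntangled (Fin k)) (p.1, i) (q.1, j)) =
      Matrix.single p.1 q.1 (1 : ℂ) := by
    ext i j
    simp only [ketbra, maxEntangled, Matrix.of_apply, Matrix.vecMulVec_apply, Pi.star_apply,
      Matrix.single_apply]
    split_ifs <;> simp_all
  simp only [choi, ampliation, Matrix.of_apply, h]

lemma posSemidef_choi {l : Type*} [Fintype l] {k : ℕ}
    {Ψ : Matrix (Fin k) (Fin k) ℂ →ₗ[ℂ] Matrix l l ℂ} (hΨ : IsChannel Ψ) : (choi Ψ).PosSemidef :=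
  hΨ.completelyPositive k _ (Matrix.posSemidef_vecMulVec_self_star _)

lemma trace_choi {l : Type*} [Fintype l] {k : ℕ}
    {Ψ : Matrix (Fin k) (Fin k) ℂ →ₗ[ℂ] Matrix l l ℂ} (hΨ : IsChannel Ψ) : (choi Ψ).trace = k := by
  have h : ∀ a : Fin k, ∑ p, Ψ (Matrix.single a a 1) p p = 1 := by
    intro a
    have := hΨ.tracePreserving (Matrix.single a a 1)
    rw [Matrix.trace_single_eq_same] at this
    exact this
  simp [Matrix.trace, Fintype.sum_prod_type, choi_apply, h]

/-- The block of the Choi matrix at `(a, b)` is the image of the matrix unit `|a⟩⟨b|`, and pairing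
with `A` weights it by `A b a`; hence the transpose. -/
lemma trace_choi_mul_kronecker {l : Type*} [Fintype l] {k : ℕ}
    (Ψ : Matrix (Fin k) (Fin k) ℂ →ₗ[ℂ] Matrix l l ℂ)
    (A : Matrix (Fin k) (Fin k) ℂ) (X : Matrix l l ℂ) :
    (choi Ψ * (A ⊗ₖ X)).trace = (Ψ A.transpose * X).trace := by
  have h : ∀ p q : l, Ψ A.transpose p q = ∑ a, ∑ b, A b a * Ψ (Matrix.single a b 1) p q := by
    intro p q
    have e : A.transpose = ∑ a, ∑ b, A b a • Matrix.single a b (1 : ℂ) := by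
      conv_lhs => rw [Matrix.matrix_eq_sum_single A.transpose]
      simp [Matrix.smul_single]
    conv_lhs => rw [e]
    simp only [map_sum, map_smul, Matrix.sum_apply, Matrix.smul_apply, smul_eq_mul]
  simp only [Matrix.trace, Matrix.diag_apply, Matrix.mul_apply, Fintype.sum_prod_type, choi_apply,
    Matrix.kroneckerMap_apply, h, Finset.sum_mul]
  rw [Finset.sum_comm]
  refine Finset.sum_congr rfl fun p _ => ?_
  rw [Finset.sum_comm (s := Finset.univ (α := l))]
  refine Finset.sum_congr rfl fun a _ => ?_
  rw [Finset.sum_comm]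
  refine Finset.sum_congr rfl fun q _ => ?_
  exact Finset.sum_congr rfl fun b _ => by ring

lemma trace_mul_ketbra {m : Type*} [Fintype m] (A : Matrix m m ℂ) (v : m → ℂ) :
    (A * ketbra v).trace = star v ⬝ᵥ A.mulVec v := by
  rw [ketbra, Matrix.mul_vecMulVec, Matrix.trace_vecMulVec, dotProduct_comm]

lemma trace_mul_kronecker_one {m l : Type*} [Fintype m] [Fintype l] [DecidableEq l]
    (Y : Matrix (m × l) (m × l) ℂ) (A : Matrix m m ℂ) :
    (Y * (A ⊗ₖ (1 : Matrix l l ℂ))).trace = (traceSnd Y * A).trace := by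
  simp only [Matrix.trace, Matrix.diag_apply, Matrix.mul_apply, Fintype.sum_prod_type,
    Matrix.kroneckerMap_apply, traceSnd, Matrix.of_apply, Matrix.one_apply, mul_ite, mul_one,
    mul_zero, Finset.sum_ite_eq', Finset.mem_univ, if_true, Finset.sum_mul]
  exact Finset.sum_congr rfl fun i _ => Finset.sum_comm

lemma trace_mul_one_kronecker {m l : Type*} [Fintype m] [Fintype l] [DecidableEq m]
    (Y : Matrix (m × l) (m × l) ℂ) (A : Matrix l l ℂ) :
    (Y * ((1 : Matrix m m ℂ) ⊗ₖ A)).trace = (traceFst Y * A).trace := by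
  have h : ∀ (i : m) (j : l), (∑ a, ∑ b, Y (i, j) (a, b) * ((if a = i then 1 else 0) * A b j)) =
      ∑ b, Y (i, j) (i, b) * A b j := by
    intro i j
    rw [Finset.sum_eq_single i (by intro a _ ha; simp [ha]) (by simp)]
    simp
  simp only [Matrix.trace, Matrix.diag_apply, Matrix.mul_apply, Fintype.sum_prod_type,
    Matrix.kroneckerMap_apply, traceFst, Matrix.of_apply, Matrix.one_apply, h, Finset.sum_mul]
  rw [Finset.sum_comm]
  exact Finset.sum_congr rfl fun i _ => Finset.sum_comm

lemma ketbra_stateVec_transpose {n : ℕ} (x : Fin n → Bool) :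
    (ketbra (stateVec x)).transpose = ketbra (stateVec x) := by
  ext i j
  rw [Matrix.transpose_apply, ketbra_stateVec_apply, ketbra_stateVec_apply, mul_comm (sgn x j)]

lemma avgFidelity_add_eq {n : ℕ}
    (Ψ : Matrix (Fin n) (Fin n) ℂ →ₗ[ℂ] Matrix (Fin n × Fin n) (Fin n × Fin n) ℂ) :
    (avgFidelity (firstState Ψ) + avgFidelity (secondState Ψ)) / 2 =
      (choi Ψ * Q n).trace.re := by
  have h : ∀ x : Fin n → Bool,
      (choi Ψ * (ketbra (stateVec x) ⊗ₖ (ketbra (stateVec x) ⊗ₖ (1 : Matrix (Fin n) (Fin n) ℂ)) +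
      ketbra (stateVec x) ⊗ₖ ((1 : Matrix (Fin n) (Fin n) ℂ) ⊗ₖ ketbra (stateVec x)))).trace.re =
      expectation (stateVec x) (firstState Ψ x) + expectation (stateVec x) (secondState Ψ x) := by
    intro x
    rw [Matrix.mul_add, Matrix.trace_add, trace_choi_mul_kronecker, trace_choi_mul_kronecker,
      ketbra_stateVec_transpose, trace_mul_kronecker_one, trace_mul_one_kronecker,
      trace_mul_ketbra, trace_mul_ketbra, Complex.add_re]
    rfl
  have hc : (1 / (2 : ℂ) ^ (n + 1)) = ((1 / (2 : ℝ) ^ (n + 1) : ℝ) : ℂ) := by push_cast; rfl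
  rw [Q, Matrix.mul_smul, Matrix.trace_smul, hc, smul_eq_mul, Complex.re_ofReal_mul,
    Matrix.mul_sum, Matrix.trace_sum, Complex.re_sum]
  simp only [h, avgFidelity, Finset.sum_add_distrib]
  rw [pow_succ]
  field_simp

/-- The trace of a product of positive semidefinite matrices is nonnegative; here the factors are
the Choi matrix, of trace `n`, and `‖Q(n)‖ · 1 - Q(n)`. -/
lemma avgFidelity_add_le {n : ℕ}
    {Ψ : Matrix (Fin n) (Fin n) ℂ →ₗ[ℂ] Matrix (Fin n × Fin n) (Fin n × Fin n) ℂ}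
    (hΨ : IsChannel Ψ) :
    (avgFidelity (firstState Ψ) + avgFidelity (secondState Ψ)) / 2 ≤ n * opNorm (Q n) := by
  have h := trace_mul_re_nonneg (posSemidef_choi hΨ)
    (posSemidef_opNorm_smul_one_sub (posSemidef_Q n).isHermitian)
  rw [Matrix.mul_sub, Matrix.trace_sub, Matrix.mul_smul, Matrix.mul_one, Matrix.trace_smul,
    trace_choi hΨ, Complex.sub_re, ← avgFidelity_add_eq, smul_eq_mul, Complex.re_ofReal_mul,
    Complex.natCast_re] at h
  linarith

/-! ### Error probability in terms of fidelity -/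

lemma expectation_stateVec {n : ℕ} (x : Fin n → Bool) (η : Matrix (Fin n) (Fin n) ℂ) :
    expectation (stateVec x) η = 1 / (n : ℝ) * ∑ i, ∑ j, sgn x i * sgn x j * (η i j).re := by
  have h : expectation (stateVec x) η = (η * ketbra (stateVec x)).trace.re := by
    rw [trace_mul_ketbra, expectation]
  simp only [h, Matrix.trace, Matrix.diag_apply, Matrix.mul_apply, ketbra_stateVec_apply,
    Complex.re_sum, Complex.re_mul_ofReal, Finset.mul_sum]
  exact Finset.sum_congr rfl fun i _ => Finset.sum_congr rfl fun j _ => by ring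

lemma expectation_outcomeVec {n : ℕ} (i j : Fin n) (b : Bool) (η : Matrix (Fin n) (Fin n) ℂ) :
    expectation (outcomeVec (i, j, b)) η =
      1 / 2 * ((η i i).re + (η j j).re + (-1) ^ b.toNat * ((η i j).re + (η j i).re)) := by
  have h2 : ((1 / Real.sqrt 2 : ℝ) : ℂ) * ((1 / Real.sqrt 2 : ℝ) : ℂ) = ((1 / 2 : ℝ) : ℂ) := by
    rw [← Complex.ofReal_mul, div_mul_div_comm, Real.mul_self_sqrt (by norm_num), one_mul]
  have h : star (outcomeVec (i, j, b)) ⬝ᵥ η.mulVec (outcomeVec (i, j, b)) = ((1 / 2 : ℝ) : ℂ) *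
      (η i i + η j j + (-1) ^ b.toNat * (η i j + η j i)) := by
    rw [← h2]
    simp only [outcomeVec, star_smul, star_add, Pi.star_single, star_one, star_pow, star_neg,
      Matrix.mulVec_smul, Matrix.mulVec_add, Matrix.mulVec_single_one, smul_dotProduct,
      dotProduct_smul, add_dotProduct, dotProduct_add, single_one_dotProduct, smul_eq_mul,
      RCLike.star_def, Complex.conj_ofReal, Matrix.col_apply]
    cases b <;> simp <;> ring
  rw [expectation, h, Complex.re_ofReal_mul]
  cases b <;> simp

/-- On each pair exactly one bit is wrong, namely the negation of `x_i ⊕ x_j`, so the interference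
term carries the sign `-(-1)^{x_i + x_j}`. -/
lemma errorProbOn_eq {n : ℕ} (M : Finpartition (Finset.univ : Finset (Fin n))) (x : Fin n → Bool)
    (η : Matrix (Fin n) (Fin n) ℂ) :
    errorProbOn M x η =
      ∑ p : Fin n × Fin n with p.1 < p.2 ∧ ({p.1, p.2} : Finset (Fin n)) ∈ M.parts,
        1 / 2 * ((η p.1 p.1).re + (η p.2 p.2).re -
          sgn x p.1 * sgn x p.2 * ((η p.1 p.2).re + (η p.2 p.1).re)) := by
  classical
  unfold errorProbOn
  symm
  refine Finset.sum_bij (fun p _ => (p.1, p.2, !(x p.1 ^^ x p.2))) ?_ ?_ ?_ ?_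
  · intro p hp
    have hp' := (Finset.mem_filter.mp hp).2
    simp [outcomes, relation, hp']
  · rintro ⟨i, j⟩ _ ⟨i', j'⟩ _ h
    simp only [Prod.mk.injEq] at h
    simp [h.1, h.2.1]
  · rintro ⟨i, j, b⟩ h
    simp only [outcomes, relation, Finset.mem_filter, Finset.mem_univ, true_and,
      Set.mem_ofPred_eq, not_and] at h
    refine ⟨(i, j), by simpa using h.1, ?_⟩
    have hb := h.2 h.1.2
    simp only [Prod.mk.injEq, true_and]
    revert hb
    cases b <;> cases x i <;> cases x j <;> simp
  · intro p _
    rw [expectation_outcomeVec]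
    unfold sgn
    cases x p.1 <;> cases x p.2 <;> norm_num <;> ring

lemma card_parts_of_isMatching {n : ℕ} {M : Finpartition (Finset.univ : Finset (Fin n))}
    (hM : IsMatching M) : M.parts.card * 2 = n := by
  have h := M.sum_card_parts
  rw [Finset.sum_congr rfl hM, Finset.sum_const, smul_eq_mul, Finset.card_univ,
    Fintype.card_fin] at h
  exact h

/-- The matchings of a maximal disjoint set cover every pair. -/
lemma IsMaximalDisjoint.exists_mem_parts {n : ℕ}
    {R : Finset (Finpartition (Finset.univ : Finset (Fin n)))} (hR : IsMaximalDisjoint R)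
    {e : Finset (Fin n)} (he : e.card = 2) : ∃ M ∈ R, e ∈ M.parts := by
  have hsub : R.biUnion (fun M => M.parts) ⊆ Finset.powersetCard 2 Finset.univ := by
    intro e he
    obtain ⟨M, hM, heM⟩ := Finset.mem_biUnion.mp he
    exact Finset.mem_powersetCard.mpr ⟨Finset.subset_univ _, hR.isMatching M hM e heM⟩
  -- Disjointness makes the count exact: `n - 1` matchings of `n / 2` pairs each give `n.choose 2`,
  -- so no pair is missed.
  have hcard : (R.biUnion fun M => M.parts).card = n.choose 2 := by
    rw [Finset.card_biUnion hR.pairwise_disjoint, Nat.choose_two_right]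
    symm
    apply Nat.div_eq_of_eq_mul_left two_pos
    rw [Finset.sum_mul, Finset.sum_congr rfl fun M hM =>
      card_parts_of_isMatching (hR.isMatching M hM), Finset.sum_const, hR.card_eq, smul_eq_mul,
      mul_comm]
  have heq := Finset.eq_of_subset_of_card_le hsub (by
    rw [hcard, Finset.card_powersetCard, Finset.card_univ, Fintype.card_fin])
  have := heq ▸ Finset.mem_powersetCard.mpr ⟨Finset.subset_univ e, he⟩
  simpa using this

lemma IsMaximalDisjoint.sum_pairs {n : ℕ}
    {R : Finset (Finpartition (Finset.univ : Finset (Fin n)))} (hR : IsMaximalDisjoint R)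
    (f : Fin n × Fin n → ℝ) :
    ∑ M ∈ R, ∑ p : Fin n × Fin n with p.1 < p.2 ∧ ({p.1, p.2} : Finset (Fin n)) ∈ M.parts, f p =
      ∑ p : Fin n × Fin n with p.1 < p.2, f p := by
  rw [← Finset.sum_biUnion]
  · refine Finset.sum_congr ?_ fun _ _ => rfl
    ext p
    simp only [Finset.mem_biUnion, Finset.mem_filter, Finset.mem_univ, true_and]
    refine ⟨fun ⟨M, _, h⟩ => h.1, fun h => ?_⟩
    obtain ⟨M, hM, hp⟩ := hR.exists_mem_parts (Finset.card_pair h.ne)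
    exact ⟨M, hM, h, hp⟩
  · intro M hM M' hM' hne
    refine Finset.disjoint_left.mpr fun p hp hp' => ?_
    exact Finset.disjoint_left.mp (hR.pairwise_disjoint M hM M' hM' hne)
      (Finset.mem_filter.mp hp).2.2 (Finset.mem_filter.mp hp').2.2

lemma sum_lt_eq_half {n : ℕ} (f : Fin n → Fin n → ℝ) (hsymm : ∀ i j, f i j = f j i)
    (hdiag : ∀ i, f i i = 0) :
    ∑ p : Fin n × Fin n with p.1 < p.2, f p.1 p.2 = 1 / 2 * ∑ i, ∑ j, f i j := by
  have h : ∀ i j, f i j = (if i < j then f i j else 0) + (if j < i then f j i else 0) := by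
    intro i j
    rcases lt_trichotomy i j with h | h | h
    · simp [h, h.not_gt]
    · simp [h, hdiag]
    · simp [h, h.not_gt, hsymm i j]
  have hs : ∑ i, ∑ j, f i j = ∑ i, ∑ j, ((if i < j then f i j else 0) +
      (if j < i then f j i else 0)) :=
    Finset.sum_congr rfl fun i _ => Finset.sum_congr rfl fun j _ => h i j
  simp only [Finset.sum_add_distrib] at hs
  rw [Finset.sum_comm (f := fun i j => if j < i then f j i else 0)] at hs
  rw [hs, Finset.sum_filter, Fintype.sum_prod_type]
  ring

/-- The summand is symmetric in `i, j` and vanishes for `i = j`, so the sum over pairs is half the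
full double sum. There the populations give `2n` times the trace and the coherences give `2n` times
the fidelity. -/
lemma errorProbAt_eq {n : ℕ} (hn : 2 ≤ n)
    {R : Finset (Finpartition (Finset.univ : Finset (Fin n)))} (hR : IsMaximalDisjoint R)
    (x : Fin n → Bool) {η : Matrix (Fin n) (Fin n) ℂ} (hη : η.trace = 1) :
    errorProbAt R x η = (n : ℝ) / (2 * ((n : ℝ) - 1)) * (1 - expectation (stateVec x) η) := by
  have hn' : (2 : ℝ) ≤ n := by exact_mod_cast hn
  have hn1 : (n : ℝ) - 1 ≠ 0 := by linarith
  have hn0 : (n : ℝ) ≠ 0 := by linarith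
  have htr : ∑ i, (η i i).re = 1 := by
    have := congrArg Complex.re hη
    simpa [Matrix.trace, Complex.re_sum] using this
  have hdiag : ∀ i, 1 / 2 * ((η i i).re + (η i i).re -
      sgn x i * sgn x i * ((η i i).re + (η i i).re)) = 0 := by
    intro i
    rw [sgn_mul_self]
    ring
  simp only [errorProbAt, errorProbOn_eq]
  rw [hR.sum_pairs fun p => 1 / 2 * ((η p.1 p.1).re + (η p.2 p.2).re -
          sgn x p.1 * sgn x p.2 * ((η p.1 p.2).re + (η p.2 p.1).re)),
    sum_lt_eq_half (fun i j => 1 / 2 * ((η i i).re + (η j j).re -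
          sgn x i * sgn x j * ((η i j).re + (η j i).re))) (fun i j => by ring) hdiag,
    hR.card_eq, Nat.cast_sub (by omega), Nat.cast_one, expectation_stateVec]
  have hswap : ∑ i, ∑ j, sgn x i * sgn x j * (η j i).re =
      ∑ i, ∑ j, sgn x i * sgn x j * (η i j).re := by
    rw [Finset.sum_comm]
    exact Finset.sum_congr rfl fun i _ => Finset.sum_congr rfl fun j _ => by ring
  simp only [← Finset.mul_sum, mul_add, Finset.sum_sub_distrib, Finset.sum_add_distrib, hswap,
    Finset.sum_const, Finset.card_univ, Fintype.card_fin, htr, nsmul_eq_mul]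
  field_simp
  ring

lemma errorProb_eq {n : ℕ} (hn : 2 ≤ n)
    {R : Finset (Finpartition (Finset.univ : Finset (Fin n)))} (hR : IsMaximalDisjoint R)
    {η : (Fin n → Bool) → Matrix (Fin n) (Fin n) ℂ} (hη : ∀ x, (η x).trace = 1) :
    errorProb R η = (n : ℝ) / (2 * ((n : ℝ) - 1)) * (1 - avgFidelity η) := by
  simp only [errorProb, avgFidelity, errorProbAt_eq hn hR _ (hη _), ← Finset.mul_sum,
    Finset.sum_sub_distrib, Finset.sum_const, Finset.card_univ, Fintype.card_fun,
    Fintype.card_bool, Fintype.card_fin, nsmul_eq_mul]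
  push_cast
  field_simp

lemma trace_traceSnd {m l : Type*} [Fintype m] [Fintype l] (A : Matrix (m × l) (m × l) ℂ) :
    (traceSnd A).trace = A.trace := by
  simp [traceSnd, Matrix.trace, Fintype.sum_prod_type]

lemma trace_traceFst {m l : Type*} [Fintype m] [Fintype l] (A : Matrix (m × l) (m × l) ℂ) :
    (traceFst A).trace = A.trace := by
  simp only [traceFst, Matrix.trace, Matrix.diag_apply, Matrix.of_apply, Fintype.sum_prod_type]
  exact Finset.sum_comm

lemma trace_ketbra_stateVec {n : ℕ} (hn : n ≠ 0) (x : Fin n → Bool) :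
    (ketbra (stateVec x)).trace = 1 := by
  have : (n : ℂ) ≠ 0 := by exact_mod_cast hn
  simp [Matrix.trace, ketbra_stateVec_apply, sgn_mul_self, this]

end HiddenMatching

/-! ### Assembly -/

theorem mainTheorem2 (n : ℕ) (hn2 : 2 ≤ n) (hn14 : n ≤ 14) (heven : Even n)
    (R : Finset (Finpartition (Finset.univ : Finset (Fin n))))
    (hR : HiddenMatching.IsMaximalDisjoint R)
    (Ψ : Matrix (Fin n) (Fin n) ℂ →ₗ[ℂ] Matrix (Fin n × Fin n) (Fin n × Fin n) ℂ)
    (hΨ : HiddenMatching.IsChannel Ψ)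
    (p₁ p₂ F G : ℝ)
    (hp₁ : p₁ = HiddenMatching.errorProb R (HiddenMatching.firstState Ψ))
    (hp₂ : p₂ = HiddenMatching.errorProb R (HiddenMatching.secondState Ψ))
    (hF : F = HiddenMatching.avgFidelity (HiddenMatching.firstState Ψ))
    (hG : G = HiddenMatching.avgFidelity (HiddenMatching.secondState Ψ)) :
    p₁ = (n : ℝ) / (2 * ((n : ℝ) - 1)) * (1 - F) ∧
    p₂ = (n : ℝ) / (2 * ((n : ℝ) - 1)) * (1 - G) ∧
    (F + G) / 2 ≤ (n : ℝ) * HiddenMatching.opNorm (HiddenMatching.Q n) ∧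
    (n : ℝ) * HiddenMatching.opNorm (HiddenMatching.Q n) ≤ 1 / 2 + 1 / (n : ℝ) ∧
    (F + G) / 2 ≤ 1 / 2 + 1 / (n : ℝ) ∧
    p₁ + p₂ ≥ 1 / 2 - 1 / (2 * ((n : ℝ) - 1)) := by
  have hn' : (2 : ℝ) ≤ n := by exact_mod_cast hn2
  have htr := HiddenMatching.trace_ketbra_stateVec (n := n) (by omega)
  have h₁ : p₁ = (n : ℝ) / (2 * ((n : ℝ) - 1)) * (1 - F) := by
    rw [hp₁, hF]
    refine HiddenMatching.errorProb_eq hn2 hR fun x => ?_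
    rw [HiddenMatching.firstState, HiddenMatching.trace_traceSnd, hΨ.tracePreserving, htr]
  have h₂ : p₂ = (n : ℝ) / (2 * ((n : ℝ) - 1)) * (1 - G) := by
    rw [hp₂, hG]
    refine HiddenMatching.errorProb_eq hn2 hR fun x => ?_
    rw [HiddenMatching.secondState, HiddenMatching.trace_traceFst, hΨ.tracePreserving, htr]
  have h₃ : (F + G) / 2 ≤ (n : ℝ) * HiddenMatching.opNorm (HiddenMatching.Q n) := by
    rw [hF, hG]
    exact HiddenMatching.avgFidelity_add_le hΨ
  have h₄ := HiddenMatching.mul_opNorm_Q_le hn2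
  refine ⟨h₁, h₂, h₃, h₄, h₃.trans h₄, ?_⟩
  have hc : (0 : ℝ) ≤ (n : ℝ) / (2 * ((n : ℝ) - 1)) :=
    div_nonneg (by linarith) (by linarith)
  have hn0 : (n : ℝ) ≠ 0 := by linarith
  have hn1 : (n : ℝ) - 1 ≠ 0 := by linarith
  have hFG : 1 - 2 / (n : ℝ) ≤ 2 - F - G := by
    have : 2 / (n : ℝ) = 2 * (1 / n) := by ring
    linarith [h₃.trans h₄]
  -- Both sides of this equality are `(n - 2) / (2 (n - 1))`.
  calc 1 / 2 - 1 / (2 * ((n : ℝ) - 1)) = (n : ℝ) / (2 * ((n : ℝ) - 1)) * (1 - 2 / (n : ℝ)) := by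
        field_simp
        ring
    _ ≤ (n : ℝ) / (2 * ((n : ℝ) - 1)) * (2 - F - G) := mul_le_mul_of_nonneg_left hFG hc
    _ = p₁ + p₂ := by rw [h₁, h₂]; ring
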